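/- Let $M_n=M_n(\mathbb C)$ with its C*-norm. For a compact Hausdorff space $Y$, call $p_1,\dots,p_n\in C(Y,M_n)$ mutually orthogonal rank one projections if $p_i=p_i^*=p_i^2$, $p_ip_j=0$ for $i\neq j$, and $p_i(y)$ has rank one for every $i$ and every $y\in Y$. An element $a\in C(Y,M_n)$ can be approximately diagonalized if for every $\varepsilon>0$ there are continuous functions $\alpha_1,\dots,\alpha_n:Y\to\mathbb C$ and mutually orthogonal rank one projections $p_1,\dots,p_n\in C(Y,M_n)$ with $\|a-\sum_{i=1}^n\alpha_ip_i\|<\varepsilon$. A unital $*$-homomorphism $\phi:C(X)\to C(Y,M_n)$, with $X$ a compact Hausdorff space, can be approximately diagonalized if for every $\varepsilon>0$ and every compact set $\mathcal F\subset C(X)$ there are continuous maps $\alpha_1,\dots,\alpha_n:Y\to X$ and mutually orthogonal rank one projections $p_1,\dots,p_n\in C(Y,M_n)$ with $\|\phi(f)-\sum_{i=1}^n f(\alpha_i)p_i\|<\varepsilon$ for all $f\in\mathcal F$. **Lemma.** Let $Y$ be a finite CW complex with $\dim Y>3$ (that is, $Y$ has a cell of dimension greater than $3$). Then there is a self-adjoint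 element $b\in C(Y,M_2)$ with spectrum $\mathrm{sp}(b)=[-1,1]$ such that $b$ cannot be approximately diagonalized, and neither can the induced unital $*$-homomorphism $C(\mathrm{sp}(b))\to C(Y,M_2)$, $f\mapsto f(b)$. -/

import Mathlib

open Topology
open scoped Matrix.Norms.L2Operator

/-- A finite CW complex is compact. -/
instance compactSpace_of_finite_cwComplex {Y : Type*} [TopologicalSpace Y] [T2Space Y]
    [CWComplex (Set.univ : Set Y)] [RelCWComplex.Finite (Set.univ : Set Y)] :
    CompactSpace Y := by
  have hfin : _root_.Finite (Σ n, RelCWComplex.cell (Set.univ : Set Y) n) :=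
    RelCWComplex.finite_cells_of_finite
  refine ⟨?_⟩
  have h : (⋃ x : (Σ n, RelCWComplex.cell (Set.univ : Set Y) n),
      RelCWComplex.closedCell x.1 x.2) = (Set.univ : Set Y) := by
    rw [Set.iUnion_sigma]
    exact CWComplex.union
  rw [← h]
  exact isCompact_iUnion fun x => RelCWComplex.isCompact_closedCell

/-- The C*-algebra `M_n = M_n(ℂ)` of complex `n × n` matrices; its norm is the operator norm with
respect to the Euclidean norm. -/
abbrev Mat (n : ℕ) : Type := Matrix (Fin n) (Fin n) ℂ

/-- `p₁, …, pₙ` are mutually orthogonal rank one projections in `C(Y, M_n)`: projections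
(self-adjoint idempotents) with pairwise products zero, of rank one at every point of `Y`. -/
structure IsOrthogonalRankOne {Y : Type*} [TopologicalSpace Y] {n : ℕ}
    (p : Fin n → C(Y, Mat n)) : Prop where
  isStarProjection : ∀ i, IsStarProjection (p i)
  orthogonal : ∀ i j, i ≠ j → p i * p j = 0
  rank_eq_one : ∀ i y, (p i y).rank = 1

/-- An element `a` of `C(Y, M_n)` can be approximately diagonalized: it is a norm limit of
elements `∑ αᵢ pᵢ`, where `αᵢ` are continuous complex functions on `Y` and `p₁, …, pₙ` are
mutually orthogonal rank one projections. -/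
def IsApproxDiagonalizable {Y : Type*} [TopologicalSpace Y] [CompactSpace Y] {n : ℕ}
    (a : C(Y, Mat n)) : Prop :=
  ∀ ε : ℝ, 0 < ε → ∃ (α : Fin n → C(Y, ℂ)) (p : Fin n → C(Y, Mat n)),
    IsOrthogonalRankOne p ∧ ‖a - ∑ i, α i • p i‖ < ε

/-- A unital *-homomorphism `φ : C(X) → C(Y, M_n)` can be approximately diagonalized: for every
`ε > 0` and every compact set `F ⊆ C(X)` there are continuous maps `αᵢ : Y → X` and mutually
orthogonal rank one projections `pᵢ` with `‖φ(f) - ∑ f(αᵢ) pᵢ‖ < ε` for all `f ∈ F`. -/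
def IsApproxDiagonalizableHom {X Y : Type*} [TopologicalSpace X] [TopologicalSpace Y]
    [CompactSpace Y] {n : ℕ} (φ : C(X, ℂ) →⋆ₐ[ℂ] C(Y, Mat n)) : Prop :=
  ∀ ε : ℝ, 0 < ε → ∀ F : Set C(X, ℂ), IsCompact F →
    ∃ (α : Fin n → C(Y, X)) (p : Fin n → C(Y, Mat n)),
      IsOrthogonalRankOne p ∧ ∀ f ∈ F, ‖φ f - ∑ i, (f.comp (α i)) • p i‖ < ε

section Degree

open Set Metric MeasureTheory
open scoped RealInnerProductSpace ContDiff NNReal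

theorem exists_eval_one_eq_sum_eval (n : ℕ) (t : Fin (n + 1) → ℝ) (ht : Function.Injective t) :
    ∃ c : Fin (n + 1) → ℝ, ∀ q : Polynomial ℝ, q.natDegree ≤ n →
      q.eval 1 = ∑ j, c j * q.eval (t j) := by
  refine ⟨fun j => (Lagrange.basis Finset.univ t j).eval 1, fun q hq => ?_⟩
  have h := Lagrange.eq_interpolate (s := Finset.univ) (v := t) (f := q) ht.injOn
    (lt_of_le_of_lt Polynomial.degree_le_natDegree (by
      rw [Finset.card_univ, Fintype.card_fin]; exact_mod_cast Nat.lt_succ_of_le hq))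
  conv_lhs => rw [h]
  simp [Lagrange.interpolate_apply, Polynomial.eval_finsetSum, mul_comm]

section NormedSpace

variable {E : Type*} [NormedAddCommGroup E] [NormedSpace ℝ E] [FiniteDimensional ℝ E]

theorem exists_polynomial_det_one_add_smul (A : E →L[ℝ] E) :
    ∃ q : Polynomial ℝ, q.natDegree ≤ Module.finrank ℝ E ∧
      ∀ t : ℝ, q.eval t = (1 + t • A).det := by
  let B := Module.finBasis ℝ E
  let M := LinearMap.toMatrix B B (A : E →ₗ[ℝ] E)
  refine ⟨Matrix.det ((Polynomial.X : Polynomial ℝ) • M.map Polynomial.C +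
    (1 : Matrix _ _ ℝ).map Polynomial.C), ?_, fun t => ?_⟩
  · simpa using Polynomial.natDegree_det_X_add_C_le M 1
  · rw [ContinuousLinearMap.det, ← LinearMap.det_toMatrix B, ← Polynomial.coe_evalRingHom,
      RingHom.map_det]
    congr 1
    ext i j
    rcases eq_or_ne i j with rfl | hij
    · simp [M, LinearMap.toMatrix_apply, add_comm, mul_comm t]
    · simp [M, LinearMap.toMatrix_apply, hij, mul_comm t]

theorem det_one_add_pos {A : E →L[ℝ] E} (hA : ‖A‖ < 1) : 0 < (1 + A).det := by
  obtain ⟨q, -, hq⟩ := exists_polynomial_det_one_add_smul A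
  have hne : ∀ t ∈ Icc (0 : ℝ) 1, q.eval t ≠ 0 := by
    intro t ht h0
    rw [hq, ContinuousLinearMap.det] at h0
    obtain ⟨x, hx, hx0⟩ := Submodule.exists_mem_ne_zero_of_ne_bot
      (LinearMap.bot_lt_ker_of_det_eq_zero h0).ne'
    have h1 : x = -(t • A x) := by
      have : x + t • A x = 0 := by simpa using hx
      exact eq_neg_of_add_eq_zero_left this
    have h2 : ‖x‖ ≤ ‖A‖ * ‖x‖ := by
      calc ‖x‖ = |t| * ‖A x‖ := by conv_lhs => rw [h1, norm_neg, norm_smul, Real.norm_eq_abs]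
        _ ≤ 1 * ‖A x‖ := by gcongr; exact abs_le.2 ⟨by linarith [ht.1], ht.2⟩
        _ ≤ _ := by simpa using A.le_opNorm x
    nlinarith [norm_pos_iff.2 hx0]
  have h0 : q.eval 0 = 1 := by simp [hq, ContinuousLinearMap.det]
  have h1 : q.eval 1 = (1 + A).det := by simp [hq]
  rw [← h1]
  by_contra! hneg
  obtain ⟨t, ht, h⟩ := intermediate_value_Icc' (zero_le_one (α := ℝ))
    (q.continuous.continuousOn) ⟨hneg, by rw [h0]; exact zero_le_one⟩
  exact hne t ht h

theorem bijective_add_smul_of_lipschitzWith {g : E → E} {K : ℝ≥0} (hg : LipschitzWith K g) {t : ℝ}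
    (ht : |t| * K < 1) : Function.Bijective fun x => x + t • g x := by
  rcases subsingleton_or_nontrivial E with hE | hE
  · exact ⟨fun x y _ => Subsingleton.elim _ _, fun y => ⟨0, Subsingleton.elim _ _⟩⟩
  have happ : ApproximatesLinearOn (fun x => x + t • g x)
      ((ContinuousLinearEquiv.refl ℝ E : E ≃L[ℝ] E) : E →L[ℝ] E) univ (‖t‖₊ * K) := by
    rw [ApproximatesLinearOn.approximatesLinearOn_iff_lipschitzOnWith, lipschitzOnWith_univ]
    have h : (fun x => x + t • g x) -
        ⇑((ContinuousLinearEquiv.refl ℝ E : E ≃L[ℝ] E) : E →L[ℝ] E) = (t • ·) ∘ g := by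
      ext x; simp
    rw [h]
    exact (lipschitzWith_smul t).comp hg
  have hc : Subsingleton E ∨ ‖t‖₊ * K <
      ‖((ContinuousLinearEquiv.refl ℝ E).symm : E →L[ℝ] E)‖₊⁻¹ := by
    right
    have : ‖((ContinuousLinearEquiv.refl ℝ E).symm : E →L[ℝ] E)‖₊ = 1 := by
      ext; simp
    rw [this, inv_one, ← NNReal.coe_lt_coe]
    simpa using ht
  exact ⟨injOn_univ.1 (happ.injOn hc), happ.surjective hc⟩

theorem image_ball_add_smul {g : E → E} {K : ℝ≥0} (hg : LipschitzWith K g)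
    (hg0 : ∀ x, x ∉ ball (0 : E) 1 → g x = 0) {t : ℝ} (ht : |t| * K < 1) :
    (fun x => x + t • g x) '' ball (0 : E) 1 = ball 0 1 := by
  have hb := bijective_add_smul_of_lipschitzWith hg ht
  rw [← compl_inj_iff, ← image_compl_eq hb]
  calc _ = id '' (ball (0 : E) 1)ᶜ := image_congr fun x hx => by simp [hg0 x hx]
    _ = _ := by simp

theorem integral_det_fderiv_eq_of_lipschitzWith [MeasurableSpace E] [BorelSpace E] (μ : Measure E)
    [μ.IsAddHaarMeasure] {g : E → E} {K : ℝ≥0} (hg : LipschitzWith K g)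
    (hg0 : ∀ x, x ∉ ball (0 : E) 1 → g x = 0) (hd : DifferentiableOn ℝ g (ball 0 1)) :
    ∫ x in ball (0 : E) 1, (1 + fderiv ℝ g x).det ∂μ = μ.real (ball 0 1) := by
  have hsmall : ∀ t : ℝ, |t| * K < 1 →
      IntegrableOn (fun x => (1 + t • fderiv ℝ g x).det) (ball 0 1) μ ∧
      ∫ x in ball (0 : E) 1, (1 + t • fderiv ℝ g x).det ∂μ = μ.real (ball 0 1) := by
    intro t ht
    have hf' : ∀ x ∈ ball (0 : E) 1, HasFDerivWithinAt (fun x => x + t • g x)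
        (1 + t • fderiv ℝ g x) (ball 0 1) x := fun x hx =>
      ((hasFDerivAt_id x).add
        ((hd.differentiableAt (isOpen_ball.mem_nhds hx)).hasFDerivAt.const_smul t)).hasFDerivWithinAt
    have hinj : InjOn (fun x => x + t • g x) (ball 0 1) :=
      (bijective_add_smul_of_lipschitzWith hg ht).1.injOn
    have hpos : ∀ x, |(1 + t • fderiv ℝ g x).det| = (1 + t • fderiv ℝ g x).det := fun x =>
      abs_of_pos <| det_one_add_pos <| by
        rw [norm_smul, Real.norm_eq_abs]
        exact (mul_le_mul_of_nonneg_left (norm_fderiv_le_of_lipschitz ℝ hg)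
          (abs_nonneg t)).trans_lt ht
    have hI := integrableOn_image_iff_integrableOn_abs_det_fderiv_smul μ measurableSet_ball hf'
      hinj (fun _ => (1 : ℝ))
    have hJ := integral_image_eq_integral_abs_det_fderiv_smul μ measurableSet_ball hf'
      hinj (fun _ => (1 : ℝ))
    rw [image_ball_add_smul hg hg0 ht] at hI hJ
    simp only [hpos, smul_eq_mul, mul_one] at hI hJ
    exact ⟨hI.1 (integrableOn_const (measure_ball_lt_top.ne)), by rw [← hJ]; simp⟩
  let n := Module.finrank ℝ E
  let t : Fin (n + 1) → ℝ := fun j => (j : ℝ) / ((n + 1) * (K + 1))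
  have htinj : Function.Injective t := fun i j h => by
    have : (0 : ℝ) < (n + 1) * (K + 1) := by positivity
    simpa [t, div_left_inj' this.ne', Fin.ext_iff] using h
  have htK : ∀ j, |t j| * K < 1 := fun j => by
    have hj : (j : ℝ) < n + 1 := by exact_mod_cast j.2
    have : (0 : ℝ) < (n + 1) * (K + 1) := by positivity
    rw [abs_of_nonneg (by positivity), div_mul_eq_mul_div, div_lt_one this]
    nlinarith [K.2, (Nat.cast_nonneg j.1 : (0 : ℝ) ≤ j)]
  obtain ⟨c, hc⟩ := exists_eval_one_eq_sum_eval n t htinj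
  have hdet : ∀ A : E →L[ℝ] E, (1 + A).det = ∑ j, c j * (1 + t j • A).det := fun A => by
    obtain ⟨q, hq, hqe⟩ := exists_polynomial_det_one_add_smul A
    simpa [hqe] using hc q hq
  have hsum : ∑ j, c j = 1 := by simpa only [Polynomial.eval_one, mul_one] using
    (hc 1 (Polynomial.natDegree_one.trans_le (Nat.zero_le _))).symm
  rw [integral_congr_ae (ae_of_all _ fun x => hdet (fderiv ℝ g x)),
    integral_finsetSum _ fun j _ => ((hsmall _ (htK j)).1.const_mul (c j))]
  simp_rw [integral_const_mul, (hsmall _ (htK _)).2]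
  rw [← Finset.sum_mul, hsum, one_mul]

end NormedSpace

variable {E : Type*} [NormedAddCommGroup E] [InnerProductSpace ℝ E] [FiniteDimensional ℝ E]

theorem not_exists_lipschitz_retraction {f : E → E} {K : ℝ≥0} (hf : LipschitzWith K f)
    (hf0 : ∀ x, x ∉ ball (0 : E) 1 → f x = x) (hd : DifferentiableOn ℝ f (ball 0 1))
    (hn : ∀ x ∈ ball (0 : E) 1, ‖f x‖ = 1) : False := by
  borelize E
  have h := integral_det_fderiv_eq_of_lipschitzWith (Measure.addHaar : Measure E)
    (g := fun x => f x - x) (hf.sub LipschitzWith.id) (fun x hx => by simp [hf0 x hx])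
    (hd.sub differentiableOn_id)
  have hz : ∀ x ∈ ball (0 : E) 1, (1 + fderiv ℝ (fun x => f x - x) x).det = 0 := by
    intro x hx
    have hdx := hd.differentiableAt (isOpen_ball.mem_nhds hx)
    have h1 : 1 + fderiv ℝ (fun x => f x - x) x = fderiv ℝ f x := by
      have h2 : fderiv ℝ (fun x => f x - x) x = _ := (hdx.hasFDerivAt.sub (hasFDerivAt_id x)).fderiv
      rw [h2]
      ext v
      simp
    rw [h1]
    by_contra hne
    have hker : ∀ v, ⟪f x, fderiv ℝ f x v⟫ = 0 := by
      intro v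
      have hc : (fun y => ⟪f y, f y⟫) =ᶠ[𝓝 x] fun _ => (1 : ℝ) := by
        filter_upwards [isOpen_ball.mem_nhds hx] with y hy
        simp [hn y hy]
      have h2 := hc.fderiv_eq (𝕜 := ℝ)
      have h3 := fderiv_inner_apply ℝ hdx hdx v
      rw [h2, real_inner_comm (f x)] at h3
      simp only [fderiv_fun_const, Pi.zero_apply, zero_apply] at h3
      linarith
    have hsurj : Function.Surjective (fderiv ℝ f x) := by
      have : IsUnit (LinearMap.det (fderiv ℝ f x : E →ₗ[ℝ] E)) := isUnit_iff_ne_zero.2 hne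
      rw [← LinearMap.isUnit_iff_isUnit_det] at this
      exact ((Module.End.isUnit_iff _).1 this).2
    obtain ⟨v, hv⟩ := hsurj (f x)
    have h4 := hker v
    rw [hv, real_inner_self_eq_norm_sq, hn x hx] at h4
    norm_num at h4
  rw [setIntegral_congr_fun measurableSet_ball hz] at h
  have : 0 < (Measure.addHaar : Measure E).real (ball 0 1) :=
    ENNReal.toReal_pos (measure_ball_pos _ _ one_pos).ne' measure_ball_lt_top.ne
  rw [integral_zero] at h
  exact this.ne h

end Degree

section Brouwer

open Set Metric
open scoped RealInnerProductSpace ContDiff NNReal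

variable {E : Type*} [NormedAddCommGroup E] [InnerProductSpace ℝ E]

/-- The radial retraction onto the closed unit ball. -/
noncomputable def radialRetraction (x : E) : E := (max 1 ‖x‖)⁻¹ • x

theorem continuous_radialRetraction : Continuous (radialRetraction : E → E) :=
  ((continuous_const.max continuous_norm).inv₀ fun _ => (lt_max_of_lt_left one_pos).ne').smul
    continuous_id

theorem norm_radialRetraction_le (x : E) : ‖radialRetraction x‖ ≤ 1 := by
  have : 0 < max 1 ‖x‖ := lt_max_of_lt_left one_pos
  rw [radialRetraction, norm_smul, norm_inv, Real.norm_of_nonneg this.le, inv_mul_le_one₀ this]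
  exact le_max_right _ _

theorem radialRetraction_of_norm_le {x : E} (hx : ‖x‖ ≤ 1) : radialRetraction x = x := by
  simp [radialRetraction, max_eq_left hx]

theorem exists_norm_eq_one_dist_le {x y : E} (hx : ‖x‖ ≤ 1) (hy : 1 ≤ ‖y‖) :
    ∃ z : E, ‖z‖ = 1 ∧ dist x z ≤ dist x y ∧ dist z y ≤ dist x y := by
  have hc : ContinuousOn (fun t : ℝ => ‖AffineMap.lineMap x y t‖) (Icc 0 1) :=
    (AffineMap.lineMap_continuous.norm).continuousOn
  obtain ⟨t, ht, h⟩ := intermediate_value_Icc (zero_le_one (α := ℝ)) hc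
    ⟨by simpa using hx, by simpa using hy⟩
  refine ⟨_, h, ?_, ?_⟩
  · rw [dist_left_lineMap, Real.norm_of_nonneg ht.1]
    exact mul_le_of_le_one_left dist_nonneg ht.2
  · rw [dist_lineMap_right, Real.norm_of_nonneg (sub_nonneg.2 ht.2)]
    exact mul_le_of_le_one_left dist_nonneg (by linarith [ht.1])

variable [FiniteDimensional ℝ E]

theorem not_exists_contDiff_extension {q : E → E} (hq : ContDiff ℝ ∞ q)
    (hq0 : ∀ x ∈ closedBall (0 : E) 1, q x ≠ 0) (hqs : ∀ x ∈ sphere (0 : E) 1, q x = x) : False := by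
  classical
  let F : E → E := fun x => ‖q x‖⁻¹ • q x
  have hF : ∀ x ∈ closedBall (0 : E) 1, ContDiffAt ℝ 1 F x := fun x hx =>
    (((hq.contDiffAt.norm ℝ (hq0 x hx)).inv (norm_ne_zero_iff.2 (hq0 x hx))).smul
      hq.contDiffAt).of_le (by exact_mod_cast le_top)
  have hFn : ∀ x ∈ closedBall (0 : E) 1, ‖F x‖ = 1 := fun x hx => by
    simp [F, norm_smul, hq0 x hx]
  have hFs : ∀ x ∈ sphere (0 : E) 1, F x = x := fun x hx => by
    have : ‖x‖ = 1 := by simpa using hx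
    simp [F, hqs x hx, this]
  obtain ⟨K, hK⟩ : ∃ K, LipschitzOnWith K F (closedBall 0 1) := by
    refine LocallyLipschitzOn.exists_lipschitzOnWith_of_compact (isCompact_closedBall 0 1) ?_
    intro x hx
    obtain ⟨K, t, ht, h⟩ := (hF x hx).exists_lipschitzOnWith
    exact ⟨K, t, mem_nhdsWithin_of_mem_nhds ht, h⟩
  let f : E → E := fun x => if x ∈ ball (0 : E) 1 then F x else x
  have hfF : ∀ x ∈ closedBall (0 : E) 1, f x = F x := fun x hx => by
    by_cases h : x ∈ ball (0 : E) 1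
    · simp only [f, if_pos h]
    · simp only [f, if_neg h]
      refine (hFs x ?_).symm
      simp only [mem_ball_zero_iff, mem_closedBall_zero_iff, mem_sphere_zero_iff_norm] at *
      linarith
  have hcross : ∀ x y : E, ‖x‖ ≤ 1 → 1 ≤ ‖y‖ → dist (f x) (f y) ≤ (K + 1) * dist x y := by
    intro x y hx hy
    obtain ⟨z, hz, h1, h2⟩ := exists_norm_eq_one_dist_le hx hy
    have hzb : z ∈ closedBall (0 : E) 1 := by simp [hz]
    have hfz : f z = z := (hfF z hzb).trans (hFs z (by simp [hz]))
    have hfy : f y = y := if_neg (by simpa using hy)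
    calc dist (f x) (f y) ≤ dist (f x) (f z) + dist (f z) (f y) := dist_triangle _ _ _
      _ ≤ K * dist x z + dist z y := by
        rw [hfz, hfy]
        gcongr
        have := hK.dist_le_mul x (by simpa using hx) z hzb
        rwa [← hfF x (by simpa using hx), ← hfF z hzb, hfz] at this
      _ ≤ K * dist x y + dist x y := by gcongr
      _ = _ := by ring
  have hf : LipschitzWith (K + 1) f := by
    refine LipschitzWith.of_dist_le_mul fun x y => ?_
    push_cast
    rcases le_total ‖x‖ 1 with hx | hx <;> rcases le_total ‖y‖ 1 with hy | hy
    · rw [hfF x (by simpa using hx), hfF y (by simpa using hy)]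
      have := hK.dist_le_mul x (by simpa using hx) y (by simpa using hy)
      nlinarith [dist_nonneg (x := x) (y := y)]
    · exact hcross x y hx hy
    · rw [dist_comm, dist_comm x]
      exact hcross y x hy hx
    · have hfx : f x = x := if_neg (by simpa using hx)
      have hfy : f y = y := if_neg (by simpa using hy)
      rw [hfx, hfy]
      nlinarith [dist_nonneg (x := x) (y := y), K.2, mul_nonneg K.2 (dist_nonneg (x := x) (y := y))]
  refine not_exists_lipschitz_retraction hf (fun x hx => if_neg hx) ?_ fun x hx => ?_
  · have : DifferentiableOn ℝ F (ball 0 1) := fun x hx =>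
      ((hF x (ball_subset_closedBall hx)).differentiableAt one_ne_zero).differentiableWithinAt
    exact this.congr fun x hx => hfF x (ball_subset_closedBall hx)
  · rw [hfF x (ball_subset_closedBall hx), hFn x (ball_subset_closedBall hx)]

theorem not_exists_contDiff_outward_field {q : E → E} (hq : ContDiff ℝ ∞ q)
    (hq0 : ∀ x ∈ closedBall (0 : E) 1, q x ≠ 0)
    (hqs : ∀ x ∈ sphere (0 : E) 1, 0 < ⟪x, q x⟫) : False := by
  have hqc := hq.continuous
  obtain ⟨c, hc, hqc'⟩ : ∃ c > 0, ∀ x ∈ closedBall (0 : E) 1, c ≤ ‖q x‖ := by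
    obtain ⟨x, hx, h⟩ := (isCompact_closedBall (0 : E) 1).exists_isMinOn
      ⟨0, by simp⟩ hqc.norm.continuousOn
    exact ⟨‖q x‖, norm_pos_iff.2 (hq0 x hx), fun y hy => h hy⟩
  obtain ⟨ρ, hρ0, hρ1, hρ⟩ : ∃ ρ : ℝ, 0 ≤ ρ ∧ ρ < 1 ∧
      ∀ x ∈ closedBall (0 : E) 1, ⟪x, q x⟫ ≤ 0 → ‖x‖ ≤ ρ := by
    let S := closedBall (0 : E) 1 ∩ {x | ⟪x, q x⟫ ≤ 0}
    have hS : IsCompact S := (isCompact_closedBall (0 : E) 1).inter_right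
      (isClosed_le (by fun_prop) continuous_const)
    obtain ⟨x, hx, h⟩ := hS.exists_isMaxOn ⟨0, by simp [S]⟩ continuous_norm.continuousOn
    refine ⟨‖x‖, norm_nonneg x, ?_, fun y hy hy' => h ⟨hy, hy'⟩⟩
    have h1 : ‖x‖ ≤ 1 := by simpa using hx.1
    exact h1.lt_of_ne fun h2 => absurd hx.2 (not_le.2 (hqs x (by simpa using h2)))
  obtain ⟨m, hm⟩ := exists_pow_lt_of_lt_one (show 0 < c / (ρ + c) by positivity) hρ1
  have hm' : (ρ ^ 2) ^ m * (ρ + c) < c := by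
    rw [← lt_div_iff₀ (by positivity), ← pow_mul, mul_comm, pow_mul]
    exact (pow_le_of_le_one (by positivity) (pow_le_one₀ hρ0 hρ1.le) two_ne_zero).trans_lt hm
  refine not_exists_contDiff_extension (q := fun x => (1 - (‖x‖ ^ 2) ^ m) • q x + (‖x‖ ^ 2) ^ m • x)
    (by have := contDiff_norm_sq ℝ (E := E) (n := ∞); fun_prop) (fun x hx h0 => ?_)
    fun x hx => ?_
  · have hx1 : ‖x‖ ≤ 1 := by simpa using hx
    set s := (‖x‖ ^ 2) ^ m with hs
    have hs1 : s ≤ 1 := pow_le_one₀ (by positivity) (pow_le_one₀ (norm_nonneg x) hx1)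
    have hs0 : 0 ≤ s := by positivity
    have hin : (1 - s) * ⟪x, q x⟫ + s * ‖x‖ ^ 2 = 0 := by
      have := congrArg (fun y => ⟪x, y⟫) h0
      simpa [inner_add_right, inner_smul_right] using this
    have hle : ⟪x, q x⟫ ≤ 0 := by
      by_contra! hpos
      have hx0 : x ≠ 0 := by rintro rfl; simp at hpos
      have h1 : 0 < ‖x‖ ^ 2 := by positivity
      nlinarith [mul_nonneg (sub_nonneg.2 hs1) hpos.le, mul_nonneg hs0 h1.le]
    have hxρ := hρ x hx hle
    have hsρ : s ≤ (ρ ^ 2) ^ m :=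
      pow_le_pow_left₀ (by positivity) (pow_le_pow_left₀ (norm_nonneg x) hxρ 2) m
    have hn : (1 - s) * ‖q x‖ = s * ‖x‖ := by
      have := congrArg norm (eq_neg_of_add_eq_zero_left h0)
      rwa [norm_neg, norm_smul, norm_smul, Real.norm_of_nonneg (sub_nonneg.2 hs1),
        Real.norm_of_nonneg hs0] at this
    nlinarith [mul_le_mul_of_nonneg_left (hqc' x hx) (sub_nonneg.2 hs1),
      mul_le_mul_of_nonneg_left hxρ hs0,
      mul_le_mul_of_nonneg_right hsρ (add_pos_of_nonneg_of_pos hρ0 hc).le]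
  · have : ‖x‖ = 1 := by simpa using hx
    simp [this]

/-- A continuous vector field on the closed unit ball that points outwards along the unit sphere
vanishes somewhere. -/
theorem not_exists_outward_field {w : E → E} (hw : ContinuousOn w (closedBall 0 1))
    (hw0 : ∀ x ∈ closedBall (0 : E) 1, w x ≠ 0)
    (hws : ∀ x ∈ sphere (0 : E) 1, 0 < ⟪x, w x⟫) : False := by
  have hW : Continuous fun x => w (radialRetraction x) :=
    hw.comp_continuous continuous_radialRetraction fun x => by
      simpa using norm_radialRetraction_le x
  have hWw : ∀ x ∈ closedBall (0 : E) 1, w (radialRetraction x) = w x := fun x hx => by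
    rw [radialRetraction_of_norm_le (by simpa using hx)]
  obtain ⟨c, hc, hwc⟩ : ∃ c > 0, ∀ x ∈ closedBall (0 : E) 1, c ≤ ‖w x‖ := by
    obtain ⟨x, hx, h⟩ := (isCompact_closedBall (0 : E) 1).exists_isMinOn
      ⟨0, by simp⟩ hw.norm
    exact ⟨‖w x‖, norm_pos_iff.2 (hw0 x hx), fun y hy => h hy⟩
  obtain ⟨d, hd, hwd⟩ : ∃ d > 0, ∀ x ∈ sphere (0 : E) 1, d ≤ ⟪x, w x⟫ := by
    rcases (sphere (0 : E) 1).eq_empty_or_nonempty with hS | hS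
    · exact ⟨1, one_pos, by simp [hS]⟩
    obtain ⟨x, hx, h⟩ := (isCompact_sphere (0 : E) 1).exists_isMinOn hS
      (ContinuousOn.inner (𝕜 := ℝ) continuousOn_id (hw.mono sphere_subset_closedBall))
    exact ⟨⟪x, w x⟫, hws x hx, fun y hy => h hy⟩
  obtain ⟨q, hq, hqw, -⟩ := hW.exists_contDiff_approx ⊤ (ε := fun _ => min c d) continuous_const
    fun _ => lt_min hc hd
  have hqw' : ∀ x ∈ closedBall (0 : E) 1, ‖w x - q x‖ < min c d := fun x hx => by
    rw [← hWw x hx, ← dist_eq_norm, dist_comm]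
    exact hqw x
  refine not_exists_contDiff_outward_field hq (fun x hx h0 => ?_) fun x hx => ?_
  · have h1 := (hqw' x hx).trans_le (min_le_left c d)
    rw [h0, sub_zero] at h1
    exact (hwc x hx).not_gt h1
  · have hx1 : ‖x‖ = 1 := by simpa using hx
    have h1 := (hqw' x (sphere_subset_closedBall hx)).trans_le (min_le_right c d)
    have h2 := real_inner_le_norm x (w x - q x)
    rw [hx1, one_mul, inner_sub_right] at h2
    linarith [hwd x hx]

end Brouwer

section Logarithm

open Set Metric Module

variable {E : Type*} [NormedAddCommGroup E] [InnerProductSpace ℝ E]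

theorem exists_continuousOn_exp_eq_compl_singleton (v : sphere (0 : E) 1)
    {f : sphere (0 : E) 1 → ℂ} (hf : Continuous f) (h0 : ∀ x, f x ≠ 0) :
    ∃ θ : sphere (0 : E) 1 → ℂ, ContinuousOn θ {v}ᶜ ∧ ∀ x ≠ v, Complex.exp (θ x) = f x := by
  have hv : ‖(v : E)‖ = 1 := by simp
  have hsc : IsSimplyConnected (univ : Set (ℝ ∙ (v : E))ᗮ) :=
    (Homeomorph.Set.univ _).symm.toHomotopyEquiv.simplyConnectedSpace_iff.1 inferInstance
  obtain ⟨φ, hφ, hφe⟩ := Complex.exists_continuousOn_eqOn_exp_comp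
    (g := f ∘ stereoInvFun hv) hsc isOpen_univ
    (hf.comp (continuous_stereoInvFun hv)).continuousOn (by rintro ⟨x, -, hx⟩; exact h0 _ hx)
  have hs := (stereographic hv).continuousOn
  rw [stereographic_source] at hs
  refine ⟨φ ∘ stereographic hv, (continuousOn_univ.1 hφ).comp_continuousOn hs, fun x hx => ?_⟩
  have h1 := hφe (mem_univ (stereographic hv x))
  have h2 : stereoInvFun hv (stereographic hv x) = x :=
    stereo_left_inv hv fun h => hx (Subtype.ext h)
  simpa [h2] using h1

theorem exists_continuous_exp_eq_of_sphere {n : ℕ} [Fact (finrank ℝ E = n + 1)] (hn : 1 < n)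
    {f : sphere (0 : E) 1 → ℂ} (hf : Continuous f) (h0 : ∀ x, f x ≠ 0) :
    ∃ θ : sphere (0 : E) 1 → ℂ, Continuous θ ∧ ∀ x, Complex.exp (θ x) = f x := by
  classical
  have hfin : finrank ℝ E = n + 1 := Fact.out
  have : FiniteDimensional ℝ E := .of_finrank_pos (by omega)
  have : Nontrivial E := nontrivial_of_finrank_pos (R := ℝ) (by omega)
  obtain ⟨v⟩ : Nonempty (sphere (0 : E) 1) := (NormedSpace.sphere_nonempty.2 zero_le_one).to_subtype
  have hv : ‖(v : E)‖ = 1 := by simp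
  have hv0 : (v : E) ≠ 0 := by rw [← norm_ne_zero_iff, hv]; exact one_ne_zero
  have hvneg : v ≠ -v := fun h => hv0 <| by
    have h1 : (v : E) = -v := congrArg Subtype.val h
    rw [eq_neg_iff_add_eq_zero, ← two_smul ℝ] at h1
    exact (smul_eq_zero.1 h1).resolve_left two_ne_zero
  obtain ⟨θ₁, hc₁, he₁⟩ := exists_continuousOn_exp_eq_compl_singleton v hf h0
  obtain ⟨θ₂, hc₂, he₂⟩ := exists_continuousOn_exp_eq_compl_singleton (-v) hf h0
  have hrank : 1 < Module.rank ℝ (ℝ ∙ (v : E))ᗮ := by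
    rw [← finrank_eq_rank, Submodule.finrank_orthogonal_span_singleton (n := n) hv0]
    exact_mod_cast hn
  have : ConnectedSpace ({0}ᶜ : Set (ℝ ∙ (v : E))ᗮ) :=
    isConnected_iff_connectedSpace.1 (isConnected_compl_singleton_of_one_lt_rank hrank 0)
  obtain ⟨w₀⟩ : Nonempty ({0}ᶜ : Set (ℝ ∙ (v : E))ᗮ) := inferInstance
  let s : ({0}ᶜ : Set (ℝ ∙ (v : E))ᗮ) → sphere (0 : E) 1 := fun w => stereoInvFun hv w
  have hs : Continuous s := (continuous_stereoInvFun hv).comp continuous_subtype_val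
  have hs₁ : ∀ w, s w ≠ v := fun w h => stereoInvFun_ne_north_pole hv w (by
    exact Subtype.ext (congrArg Subtype.val h))
  have hs₂ : ∀ w, s w ≠ -v := fun w h => w.2 <| by
    have h1 : stereographic hv (s w) = w := stereo_right_inv hv _
    rw [h, stereographic_apply_neg] at h1
    exact h1.symm
  have hs₃ : ∀ x, x ≠ v → x ≠ -v → ∃ w, s w = x := fun x hx hx' => by
    have h2 : stereoInvFun hv (stereographic hv x) = x :=
      stereo_left_inv hv fun h => hx (Subtype.ext h)
    refine ⟨⟨stereographic hv x, fun h => hx' ?_⟩, h2⟩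
    rw [← h2, mem_singleton_iff.1 h, ← stereographic_apply_neg v]
    exact (stereo_left_inv hv fun h => hvneg (Subtype.ext h.symm))
  let d : ℂ := θ₁ (s w₀) - θ₂ (s w₀)
  have hd : Complex.exp d = 1 := by
    rw [Complex.exp_sub, he₁ _ (hs₁ _), he₂ _ (hs₂ _), div_self (h0 _)]
  have heq : θ₁ ∘ s = fun w => θ₂ (s w) + d := by
    refine Complex.isCoveringMap_exp.eq_of_comp_eq (hc₁.comp_continuous hs hs₁)
      ((hc₂.comp_continuous hs hs₂).add continuous_const) ?_ w₀ (by simp [d])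
    funext w
    refine Subtype.ext ?_
    simp [Complex.exp_add, hd, he₁ _ (hs₁ w), he₂ _ (hs₂ w)]
  refine ⟨fun x => if x = v then θ₂ x + d else θ₁ x, ?_, fun x => ?_⟩
  · refine continuous_iff_continuousAt.2 fun x => ?_
    by_cases hx : x = v
    · have h1 : ContinuousAt (fun x => θ₂ x + d) x :=
        (hc₂.continuousAt (isOpen_compl_singleton.mem_nhds (by rw [hx]; exact hvneg))).add
          continuousAt_const
      refine h1.congr ?_
      filter_upwards [isOpen_compl_singleton.mem_nhds
        (show x ∈ ({-v}ᶜ : Set _) by rw [hx]; exact hvneg)] with y hy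
      split_ifs with h
      · rfl
      · obtain ⟨w, rfl⟩ := hs₃ y h hy
        exact (congrFun heq w).symm
    · have hmem := isOpen_compl_singleton.mem_nhds (show x ∈ ({v}ᶜ : Set _) from hx)
      refine (hc₁.continuousAt hmem).congr ?_
      filter_upwards [hmem] with y hy
      exact (if_neg hy).symm
  · dsimp only
    split_ifs with h
    · rw [Complex.exp_add, hd, mul_one, he₂ _ (by rw [h]; exact hvneg)]
    · exact he₁ _ h

end Logarithm

section Section

open Set Metric Module

/-- A continuous family of idempotents over the unit ball, nonzero at the centre, has a nowhere
vanishing section. -/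
theorem exists_continuousOn_section {E F : Type*} [NormedAddCommGroup E] [NormedSpace ℝ E]
    [FiniteDimensional ℝ E] [NormedAddCommGroup F] [NormedSpace ℂ F] {P : E → F →L[ℂ] F}
    (hP : ContinuousOn P (closedBall 0 1))
    (hid : ∀ x ∈ closedBall (0 : E) 1, P x * P x = P x) (h0 : P 0 ≠ 0) :
    ∃ v : E → F, ContinuousOn v (closedBall 0 1) ∧
      ∀ x ∈ closedBall (0 : E) 1, v x ≠ 0 ∧ P x (v x) = v x := by
  obtain ⟨δ, hδ, hPδ⟩ := Metric.uniformContinuousOn_iff.1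
    ((isCompact_closedBall (0 : E) 1).uniformContinuousOn_of_continuous hP) 1 one_pos
  obtain ⟨n, hn⟩ := exists_nat_one_div_lt hδ
  have hmem : ∀ x ∈ closedBall (0 : E) 1, ∀ k : ℕ, k ≤ n + 1 →
      ((k : ℝ) / (n + 1)) • x ∈ closedBall (0 : E) 1 := fun x hx k hk => by
    rw [mem_closedBall_zero_iff] at *
    rw [norm_smul, Real.norm_of_nonneg (by positivity)]
    refine mul_le_one₀ ?_ (norm_nonneg x) hx
    rw [div_le_one (by positivity)]
    exact_mod_cast hk
  have key : ∀ k : ℕ, k ≤ n + 1 → ∃ v : E → F, ContinuousOn v (closedBall 0 1) ∧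
      ∀ x ∈ closedBall (0 : E) 1, v x ≠ 0 ∧ P (((k : ℝ) / (n + 1)) • x) (v x) = v x := by
    intro k
    induction k with
    | zero =>
      intro _
      obtain ⟨u, hu⟩ : ∃ u, P 0 u ≠ 0 := by
        by_contra! h
        exact h0 (ContinuousLinearMap.ext h)
      refine ⟨fun _ => P 0 u, continuousOn_const, fun x _ => ⟨hu, ?_⟩⟩
      simpa using DFunLike.congr_fun (hid 0 (by simp)) u
    | succ k ih =>
      intro hk
      obtain ⟨v, hv, hvP⟩ := ih (by omega)
      refine ⟨fun x => P (((k + 1 : ℕ) / (n + 1) : ℝ) • x) (v x), ?_, fun x hx => ⟨fun hz => ?_, ?_⟩⟩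
      · exact (hP.comp (by fun_prop) fun x hx => hmem x hx _ hk).clm_apply hv
      · obtain ⟨hv0, hvk⟩ := hvP x hx
        have hd : dist (((k : ℝ) / (n + 1)) • x) (((k + 1 : ℕ) / (n + 1) : ℝ) • x) < δ := by
          rw [dist_eq_norm, ← sub_smul, norm_smul]
          have h1 : ‖(k : ℝ) / (n + 1) - (k + 1 : ℕ) / (n + 1)‖ = 1 / (n + 1) := by
            rw [← sub_div, Nat.cast_add_one, sub_add_cancel_left, norm_div, norm_neg, norm_one,
              Real.norm_of_nonneg (by positivity)]
          rw [h1]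
          exact (mul_le_of_le_one_right (by positivity) (by simpa using hx)).trans_lt hn
        have h2 := hPδ _ (hmem x hx k (by omega)) _ (hmem x hx _ hk) hd
        rw [dist_eq_norm] at h2
        replace hz : P (((k + 1 : ℕ) / (n + 1) : ℝ) • x) (v x) = 0 := hz
        have h3 := (P (((k : ℝ) / (n + 1)) • x) - P (((k + 1 : ℕ) / (n + 1) : ℝ) • x)).le_opNorm (v x)
        rw [sub_apply, hvk, hz, sub_zero] at h3
        nlinarith [norm_pos_iff.2 hv0]
      · exact DFunLike.congr_fun (hid _ (hmem x hx _ hk)) (v x)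
  obtain ⟨v, hv, hvP⟩ := key (n + 1) le_rfl
  refine ⟨v, hv, fun x hx => ?_⟩
  have := hvP x hx
  rwa [Nat.cast_add_one, div_self (by positivity), one_smul] at this

end Section

section Hopf

open Set Metric Module
open scoped ComplexInnerProductSpace

local notation "ℂ²" => EuclideanSpace ℂ (Fin 2)

theorem finrank_real_euclideanSpace_complex_two : finrank ℝ (ℂ²) = 3 + 1 := by
  rw [finrank_real_of_complex]
  simp

theorem not_exists_section_of_inner_ne_zero
    {v : ℂ² → ℂ²}
    (hv : ContinuousOn v (closedBall 0 1)) (hv0 : ∀ x ∈ closedBall 0 1, v x ≠ 0)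
    (hvs : ∀ x ∈ sphere 0 1, ⟪x, v x⟫ ≠ 0) : False := by
  have : Fact (finrank ℝ (ℂ²) = 3 + 1) :=
    ⟨finrank_real_euclideanSpace_complex_two⟩
  have hf : Continuous fun x : sphere (0 : ℂ²) 1 => ⟪(x : ℂ²), v x⟫ :=
    continuous_subtype_val.inner <| hv.comp_continuous continuous_subtype_val
      fun x => sphere_subset_closedBall x.2
  obtain ⟨θ, hθ, hθe⟩ := exists_continuous_exp_eq_of_sphere (n := 3) (by norm_num) hf fun x => hvs x x.2
  obtain ⟨Θ, hΘ⟩ := ContinuousMap.exists_restrict_eq isClosed_sphere ⟨θ, hθ⟩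
  refine not_exists_outward_field (w := fun x => Complex.exp (-Θ x) • v x)
    (ContinuousOn.smul (Complex.continuous_exp.comp Θ.continuous.neg).continuousOn hv)
    (fun x hx => smul_ne_zero (Complex.exp_ne_zero _) (hv0 x hx)) fun x hx => ?_
  have h1 : Θ x = θ ⟨x, hx⟩ := DFunLike.congr_fun hΘ ⟨x, hx⟩
  have h2 : ⟪x, Complex.exp (-Θ x) • v x⟫ = 1 := by
    rw [inner_smul_right, h1, Complex.exp_neg, hθe ⟨x, hx⟩, inv_mul_cancel₀ (hvs x hx)]
  have h3 : inner ℝ x (Complex.exp (-Θ x) • v x) = (⟪x, Complex.exp (-Θ x) • v x⟫).re := by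
    simp [PiLp.inner_apply]
    ring
  rw [h3, h2]
  simp

/-- The quaternionic structure on `ℂ²`. -/
noncomputable def quaternionicJ (v : ℂ²) : ℂ² :=
  !₂[-(starRingEnd ℂ) (v 1), (starRingEnd ℂ) (v 0)]

theorem continuous_quaternionicJ : Continuous quaternionicJ := by
  unfold quaternionicJ
  fun_prop

theorem norm_inner_sq_add_norm_inner_quaternionicJ_sq (z v : ℂ²) :
    ‖⟪z, v⟫‖ ^ 2 + ‖⟪z, quaternionicJ v⟫‖ ^ 2 = ‖z‖ ^ 2 * ‖v‖ ^ 2 := by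
  simp only [EuclideanSpace.norm_sq_eq, Fin.sum_univ_two, PiLp.inner_apply, quaternionicJ,
    ← Complex.normSq_eq_norm_sq, Complex.normSq_apply]
  simp
  ring

/-- If `v` is an eigenvector of an operator at distance less than one from the reflection
`x ↦ 2⟪z, x⟫z - x`, then `v` is not at angle `π / 4` with `z`. -/
theorem two_mul_norm_inner_sq_ne {z v : ℂ²} (hz : ‖z‖ = 1) {α : ℂ}
    (h : ‖((2 * ⟪z, v⟫) • z - v) - α • v‖ < ‖v‖) : 2 * ‖⟪z, v⟫‖ ^ 2 ≠ ‖v‖ ^ 2 := by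
  intro heq
  have h1 : ‖(2 * ⟪z, v⟫) • z - v - α • v‖ ^ 2 =
      4 * ‖⟪z, v⟫‖ ^ 2 - 4 * (1 + α.re) * ‖⟪z, v⟫‖ ^ 2 + Complex.normSq (1 + α) * ‖v‖ ^ 2 := by
    have h3 : (2 * ⟪z, v⟫) • z - v - α • v = (2 * ⟪z, v⟫) • z - (1 + α) • v := by
      rw [add_smul, one_smul, sub_sub]
    have h4 : ⟪(2 * ⟪z, v⟫) • z, (1 + α) • v⟫ = 2 * (1 + α) * (‖⟪z, v⟫‖ ^ 2 : ℝ) := by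
      rw [inner_smul_left, inner_smul_right, ← Complex.normSq_eq_norm_sq,
        Complex.normSq_eq_conj_mul_self]
      rw [map_mul, Complex.conj_ofNat]
      ring
    rw [h3, @norm_sub_sq ℂ, h4, RCLike.re_eq_complex_re, Complex.re_mul_ofReal, norm_smul, norm_smul,
      hz, Complex.normSq_eq_norm_sq]
    simp
    ring
  have h2 : ‖(2 * ⟪z, v⟫) • z - v - α • v‖ ^ 2 < ‖v‖ ^ 2 := by gcongr
  rw [h1, ← heq, Complex.normSq_apply] at h2
  simp at h2
  nlinarith [mul_nonneg (sq_nonneg ‖⟪z, v⟫‖) (add_nonneg (sq_nonneg α.re) (sq_nonneg α.im))]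

theorem not_exists_approx_eigenprojection
    {P A : ℂ² → ℂ² →L[ℂ] ℂ²}
    {α : ℂ² → ℂ} (hP : ContinuousOn P (closedBall 0 1))
    (hid : ∀ x ∈ closedBall 0 1, P x * P x = P x) (h0 : P 0 ≠ 0)
    (hA : ∀ x ∈ sphere 0 1, A x * P x = α x • P x)
    (hAx : ∀ x ∈ sphere 0 1, ∀ v, v ≠ 0 → ‖((2 * ⟪x, v⟫) • x - v) - A x v‖ < ‖v‖) : False := by
  obtain ⟨v, hv, hvP⟩ := exists_continuousOn_section hP hid h0
  have hvs := hv.mono sphere_subset_closedBall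
  have hne : ∀ x ∈ sphere (0 : ℂ²) 1, 2 * ‖⟪x, v x⟫‖ ^ 2 ≠ ‖v x‖ ^ 2 := by
    intro x hx
    obtain ⟨h1, h2⟩ := hvP x (sphere_subset_closedBall hx)
    refine two_mul_norm_inner_sq_ne (α := α x) (by simpa using hx) ?_
    have h3 := DFunLike.congr_fun (hA x hx) (v x)
    simp only [mul_apply_eq_comp, smul_apply, h2] at h3
    rw [← h3]
    exact hAx x hx _ h1
  have hrank : 1 < Module.rank ℝ (ℂ²) := by
    rw [← finrank_eq_rank, finrank_real_euclideanSpace_complex_two]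
    norm_num
  have hcon := isPreconnected_sphere hrank (0 : ℂ²) 1
  have hin : ContinuousOn (fun x => 2 * ‖⟪x, v x⟫‖ ^ 2) (sphere 0 1) :=
    ((continuousOn_id.inner hvs).norm.pow 2).const_mul 2
  have hnv : ContinuousOn (fun x => ‖v x‖ ^ 2) (sphere 0 1) := hvs.norm.pow 2
  have hdich : (∀ x ∈ sphere (0 : ℂ²) 1, ‖v x‖ ^ 2 < 2 * ‖⟪x, v x⟫‖ ^ 2) ∨
      ∀ x ∈ sphere (0 : ℂ²) 1, 2 * ‖⟪x, v x⟫‖ ^ 2 < ‖v x‖ ^ 2 := by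
    by_contra! hcon'
    obtain ⟨⟨x, hx, hx'⟩, y, hy, hy'⟩ := hcon'
    obtain ⟨w, hw, hweq⟩ := hcon.intermediate_value₂ hx hy hin hnv hx' hy'
    exact hne w hw hweq
  rcases hdich with h | h
  · refine not_exists_section_of_inner_ne_zero hv (fun x hx => (hvP x hx).1) fun x hx hz => ?_
    have := h x hx
    rw [hz] at this
    simp at this
    nlinarith [sq_nonneg ‖v x‖]
  · refine not_exists_section_of_inner_ne_zero (v := fun x => quaternionicJ (v x))
      (continuous_quaternionicJ.comp_continuousOn hv) (fun x hx hz => (hvP x hx).1 ?_)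
      fun x hx hz => ?_
    · have e0 := congrArg (fun w : ℂ² => w 0) hz
      have e1 := congrArg (fun w : ℂ² => w 1) hz
      ext i
      fin_cases i <;> simp_all [quaternionicJ]
    · have h1 := norm_inner_sq_add_norm_inner_quaternionicJ_sq x (v x)
      have hx1 : ‖x‖ = 1 := by simpa using hx
      rw [hz, hx1, norm_zero] at h1
      have := h x hx
      nlinarith [sq_nonneg ‖v x‖]

end Hopf

section HopfMatrix

open Set Metric
open scoped ComplexInnerProductSpace

local notation "ℂ²" => EuclideanSpace ℂ (Fin 2)

/-- The matrix of `x ↦ 2⟪z, x⟫z - ‖z‖²x`: the cone over the Hopf map. -/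
noncomputable def hopfMatrix (z : ℂ²) : Mat 2 :=
  !![z 0 * star (z 0) - z 1 * star (z 1), 2 * z 0 * star (z 1);
    2 * z 1 * star (z 0), z 1 * star (z 1) - z 0 * star (z 0)]

theorem continuous_hopfMatrix : Continuous hopfMatrix := by
  refine continuous_matrix fun i j => ?_
  fin_cases i <;> fin_cases j <;> simp [hopfMatrix] <;> fun_prop

theorem isSelfAdjoint_hopfMatrix (z : ℂ²) : IsSelfAdjoint (hopfMatrix z) := by
  ext i j
  fin_cases i <;> fin_cases j <;> simp [hopfMatrix, Matrix.star_apply] <;> ring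

theorem ofReal_norm_sq_eq (z : ℂ²) :
    ((‖z‖ ^ 2 : ℝ) : ℂ) = z 0 * star (z 0) + z 1 * star (z 1) := by
  simp [EuclideanSpace.norm_sq_eq, Complex.mul_conj, Complex.normSq_eq_norm_sq]

theorem hopfMatrix_mul_self (z : ℂ²) :
    hopfMatrix z * hopfMatrix z = (((‖z‖ ^ 2 : ℝ) : ℂ) ^ 2) • (1 : Mat 2) := by
  rw [ofReal_norm_sq_eq]
  ext i j
  fin_cases i <;> fin_cases j <;> simp [hopfMatrix, Matrix.mul_apply] <;> ring

theorem norm_hopfMatrix (z : ℂ²) : ‖hopfMatrix z‖ = ‖z‖ ^ 2 := by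
  have h : ‖hopfMatrix z‖ * ‖hopfMatrix z‖ = (‖z‖ ^ 2) * (‖z‖ ^ 2) := by
    rw [← CStarRing.norm_star_mul_self, (isSelfAdjoint_hopfMatrix z).star_eq, hopfMatrix_mul_self,
      norm_smul, norm_one, norm_pow, Complex.norm_real, Real.norm_of_nonneg (by positivity)]
    ring
  exact (mul_self_inj (norm_nonneg _) (by positivity)).1 h

theorem toEuclideanCLM_hopfMatrix_apply (z x : ℂ²) :
    Matrix.toEuclideanCLM (n := Fin 2) (𝕜 := ℂ) (hopfMatrix z) x =
      (2 * ⟪z, x⟫) • z - ((‖z‖ ^ 2 : ℝ) : ℂ) • x := by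
  rw [ofReal_norm_sq_eq]
  ext i
  rw [Matrix.ofLp_toEuclideanCLM]
  fin_cases i <;> simp [hopfMatrix, Matrix.mulVec, dotProduct, PiLp.inner_apply] <;> ring

theorem mem_spectrum_hopfMatrix {t : ℝ} {z : ℂ²} (hz : ‖z‖ ^ 2 = |t|) :
    (t : ℂ) ∈ spectrum ℂ (hopfMatrix z) := by
  intro h
  have h1 : (algebraMap ℂ (Mat 2) t - hopfMatrix z) * (algebraMap ℂ (Mat 2) t + hopfMatrix z) = 0 := by
    have h2 : algebraMap ℂ (Mat 2) t * hopfMatrix z = hopfMatrix z * algebraMap ℂ (Mat 2) t :=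
      Algebra.commutes _ _
    rw [sub_mul, mul_add, mul_add, hopfMatrix_mul_self, ← h2, ← map_mul, hz,
      Algebra.algebraMap_eq_smul_one]
    norm_cast
    simp [sq]
    abel
  have h3 := (h.mul_right_eq_zero).1 h1
  have h4 : (t : ℂ) * (1 + 1) = 0 := by
    have := congrArg Matrix.trace h3
    simp only [hopfMatrix, Matrix.trace, Matrix.diag_apply, Matrix.add_apply, Fin.sum_univ_two,
      Matrix.algebraMap_matrix_apply] at this
    simp at this
    linear_combination this
  have h5 : t = 0 := by
    norm_num at h4
    exact h4
  have h6 : z = 0 := by simpa [h5] using hz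
  rw [h5, h6] at h
  have : hopfMatrix 0 = 0 := by ext i j; fin_cases i <;> fin_cases j <;> simp [hopfMatrix]
  simp [this, spectrum.mem_resolventSet_iff] at h

variable {Y : Type*} [TopologicalSpace Y]

/-- No extension of the cone over the Hopf map is close to a diagonalizable element. -/
theorem one_le_norm_sub_of_isOrthogonalRankOne [CompactSpace Y] {ι : ℂ² → Y} (hι : Continuous ι)
    {b : C(Y, Mat 2)} (hb : ∀ z ∈ sphere (0 : ℂ²) 1, b (ι z) = hopfMatrix z)
    (α : Fin 2 → C(Y, ℂ)) {p : Fin 2 → C(Y, Mat 2)} (hp : IsOrthogonalRankOne p) :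
    1 ≤ ‖b - ∑ i, α i • p i‖ := by
  by_contra! hlt
  let T := Matrix.toEuclideanCLM (n := Fin 2) (𝕜 := ℂ)
  have hT : Continuous T := (AddMonoidHomClass.isometry_of_norm T fun A => (Matrix.cstar_norm_def A).symm).continuous
  refine not_exists_approx_eigenprojection (P := fun z => T (p 0 (ι z)))
    (A := fun z => T ((∑ i, α i • p i : C(Y, Mat 2)) (ι z))) (α := fun z => α 0 (ι z))
    (hT.comp ((p 0).continuous.comp hι)).continuousOn (fun x _ => ?_) ?_ (fun x _ => ?_)
    fun x hx v hv => ?_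
  · rw [← map_mul]
    exact congrArg T (DFunLike.congr_fun (hp.isStarProjection 0).isIdempotentElem (ι x))
  · intro h
    have h0 : p 0 (ι 0) = 0 := T.injective (h.trans (map_zero T).symm)
    have := hp.rank_eq_one 0 (ι 0)
    rw [h0, Matrix.rank_zero] at this
    exact zero_ne_one this
  · have h1 : p 0 (ι x) * p 0 (ι x) = p 0 (ι x) :=
      DFunLike.congr_fun (hp.isStarProjection 0).isIdempotentElem (ι x)
    have h2 : p 1 (ι x) * p 0 (ι x) = 0 := DFunLike.congr_fun (hp.orthogonal 1 0 one_ne_zero) (ι x)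
    rw [← map_mul, ← map_smul]
    congr 1
    simp [add_mul, h1, h2]
  · have hx1 : ‖x‖ = 1 := by simpa using hx
    have h1 := toEuclideanCLM_hopfMatrix_apply x v
    rw [hx1, one_pow, Complex.ofReal_one, one_smul] at h1
    rw [← h1, ← hb x hx]
    change ‖T _ v - T _ v‖ < _
    rw [← sub_apply, ← map_sub]
    refine ((T _).le_opNorm v).trans_lt ?_
    have h2 : ‖T (b (ι x) - (∑ i, α i • p i : C(Y, Mat 2)) (ι x))‖ < 1 :=
      ((b - ∑ i, α i • p i).norm_coe_le_norm (ι x)).trans_lt hlt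
    have := norm_pos_iff.2 hv
    nlinarith

/-- If the unit ball of `ℂ²` embeds into `Y`, then the cone over the Hopf map extends to a
self-adjoint element of `C(Y, M₂)` with spectrum `[-1, 1]`. -/
theorem exists_extension_hopfMatrix [CompactSpace Y] [T2Space Y] {ι : ℂ² → Y} (hι : Continuous ι)
    (hinj : InjOn ι (closedBall 0 1)) :
    ∃ b : C(Y, Mat 2), IsSelfAdjoint b ∧ (∀ z ∈ closedBall (0 : ℂ²) 1, b (ι z) = hopfMatrix z) ∧
      spectrum ℂ b = Complex.ofReal '' Icc (-1 : ℝ) 1 := by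
  have he : IsClosedEmbedding ((closedBall (0 : ℂ²) 1).domRestrict ι) :=
    (hι.comp continuous_subtype_val).isClosedEmbedding (injOn_iff_injective.1 hinj)
  obtain ⟨c, hc, hce⟩ := ContinuousMap.exists_extension_forall_mem he
    ⟨fun z => hopfMatrix z, continuous_hopfMatrix.comp continuous_subtype_val⟩
    (t := closedBall (0 : Mat 2) 1) fun z => by
      have hz : ‖(z : ℂ²)‖ ≤ 1 := mem_closedBall_zero_iff.1 z.2
      simpa [norm_hopfMatrix] using hz
  have hcz : ∀ z ∈ closedBall (0 : ℂ²) 1, c (ι z) = hopfMatrix z := fun z hz =>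
    DFunLike.congr_fun hce ⟨z, hz⟩
  have hcn : ‖c‖ ≤ 1 := (ContinuousMap.norm_le _ zero_le_one).2 fun y => by simpa using hc y
  let b : C(Y, Mat 2) := (1 / 2 : ℂ) • (c + star c)
  have hb : IsSelfAdjoint b := by
    have h1 : IsSelfAdjoint (1 / 2 : ℂ) := by simp [isSelfAdjoint_iff]
    exact h1.smul (IsSelfAdjoint.add_star_self c)
  have hbz : ∀ z ∈ closedBall (0 : ℂ²) 1, b (ι z) = hopfMatrix z := fun z hz => by
    simp only [b, ContinuousMap.smul_apply, ContinuousMap.add_apply, ContinuousMap.star_apply,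
      hcz z hz, (isSelfAdjoint_hopfMatrix z).star_eq]
    rw [← two_smul ℂ, smul_smul]
    norm_num
  have hbn : ‖b‖ ≤ 1 := by
    rw [norm_smul]
    have := norm_add_le c (star c)
    have h2 : ‖star c‖ = ‖c‖ := norm_star c
    norm_num
    linarith
  refine ⟨b, hb, hbz, Subset.antisymm (fun w hw => ?_) ?_⟩
  · have h1 := hb.mem_spectrum_eq_re hw
    have : Nonempty Y := ⟨ι 0⟩
    have h2 := (spectrum.norm_le_norm_of_mem hw).trans hbn
    refine ⟨w.re, abs_le.1 ((Complex.abs_re_le_norm w).trans h2), h1.symm⟩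
  · rintro _ ⟨t, ht, rfl⟩
    let z : ℂ² := !₂[(√|t| : ℂ), 0]
    have hz : ‖z‖ ^ 2 = |t| := by
      simp [z, EuclideanSpace.norm_sq_eq]
    have hz1 : z ∈ closedBall (0 : ℂ²) 1 := by
      have : ‖z‖ ^ 2 ≤ 1 := hz.trans_le (abs_le.2 ht)
      simpa using this
    have h1 := mem_spectrum_hopfMatrix hz
    intro hu
    refine h1 ?_
    rw [← hbz z hz1]
    exact hu.map (Pi.evalRingHom (fun _ => Mat 2) (ι z) |>.comp ContinuousMap.coeFnRingHom)

end HopfMatrix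

section Cell

open Set Metric

theorem exists_continuous_injOn_closedBall_of_cell {Y : Type*} [TopologicalSpace Y]
    [CWComplex (Set.univ : Set Y)] {n : ℕ} (c : RelCWComplex.cell (Set.univ : Set Y) n)
    {E : Type*} [NormedAddCommGroup E] [InnerProductSpace ℝ E] [FiniteDimensional ℝ E]
    (hn : Module.finrank ℝ E ≤ n) :
    ∃ ι : E → Y, Continuous ι ∧ InjOn ι (closedBall 0 1) := by
  obtain ⟨L, hL⟩ : ∃ L : E →ₗ[ℝ] (Fin n → ℝ), Function.Injective L :=
    finrank_le_iff_exists_linearMap.1 (by simpa using hn)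
  let L' : E →L[ℝ] (Fin n → ℝ) := (‖L.toContinuousLinearMap‖ + 1)⁻¹ • L.toContinuousLinearMap
  have hpos : 0 < ‖L.toContinuousLinearMap‖ + 1 := by positivity
  have hL'inj : Function.Injective L' := fun x y h => hL <| by
    simpa [L', hpos.ne'] using h
  have hL' : ∀ x : E, ‖x‖ ≤ 1 → L' x ∈ ball 0 1 := fun x hx => by
    have h1 : ‖L'‖ < 1 := by
      rw [norm_smul, norm_inv, Real.norm_of_nonneg hpos.le, inv_mul_lt_one₀ hpos]
      linarith
    rw [mem_ball_zero_iff]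
    exact (L'.le_opNorm x).trans_lt (by nlinarith [norm_nonneg L', norm_nonneg x])
  refine ⟨fun x => RelCWComplex.map n c (L' (radialRetraction x)), ?_, fun x hx y hy h => ?_⟩
  · exact (RelCWComplex.continuousOn n c).comp_continuous
      (L'.continuous.comp continuous_radialRetraction)
      fun x => ball_subset_closedBall (hL' _ (norm_radialRetraction_le x))
  · have hx' : ‖x‖ ≤ 1 := by simpa using hx
    have hy' : ‖y‖ ≤ 1 := by simpa using hy
    simp only [radialRetraction_of_norm_le hx', radialRetraction_of_norm_le hy'] at h
    refine hL'inj ((RelCWComplex.map n c).injOn ?_ ?_ h) <;> rw [RelCWComplex.source_eq]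
    · exact hL' x hx'
    · exact hL' y hy'

end Cell

theorem lemma7p7 {Y : Type*} [TopologicalSpace Y] [T2Space Y]
    [CWComplex (Set.univ : Set Y)] [RelCWComplex.Finite (Set.univ : Set Y)]
    (hdim : ∃ n : ℕ, 3 < n ∧ Nonempty (RelCWComplex.cell (Set.univ : Set Y) n)) :
    ∃ (b : C(Y, Mat 2)) (hb : IsSelfAdjoint b),
      spectrum ℂ b = Complex.ofReal '' Set.Icc (-1 : ℝ) 1 ∧
      ¬ IsApproxDiagonalizable b ∧
      ¬ IsApproxDiagonalizableHom (cfcHom (R := ℂ) hb.isStarNormal) := by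
  obtain ⟨n, hn, ⟨c⟩⟩ := hdim
  obtain ⟨ι, hι, hinj⟩ := exists_continuous_injOn_closedBall_of_cell c
    (E := EuclideanSpace ℂ (Fin 2)) (finrank_real_euclideanSpace_complex_two.trans_le hn)
  obtain ⟨b, hb, hbz, hsp⟩ := exists_extension_hopfMatrix hι hinj
  have hfar := @one_le_norm_sub_of_isOrthogonalRankOne Y _ _ ι hι b
    fun z hz => hbz z (Metric.sphere_subset_closedBall hz)
  refine ⟨b, hb, hsp, fun h => ?_, fun h => ?_⟩
  · obtain ⟨α, p, hp, hlt⟩ := h 1 one_pos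
    exact (hfar α hp).not_gt hlt
  · let f : C(spectrum ℂ b, ℂ) := (ContinuousMap.id ℂ).restrict (spectrum ℂ b)
    obtain ⟨α, p, hp, hlt⟩ := h 1 one_pos {f} isCompact_singleton
    have h1 := hlt f rfl
    rw [cfcHom_id] at h1
    exact (hfar _ hp).not_gt h1
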